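/- Let $q$ and $m$ be integers with $1\le m\le\lfloor q/2\rfloor$, let $J>0$ and put $\theta=e^{J}$, $\theta_m=1+2\sqrt{m(q-m)}$, $\theta_c=q+1$. Let $\Gamma^2=(V,L)$ be the Cayley tree of order $2$ (the infinite tree in which every vertex has $3$ neighbors), with origin $0$; let $|t|$ be the distance from $0$ to $t$, $V_n=\{t\in V:|t|\le n\}$, and $\Omega=\{1,\dots,q\}^V$. A direct successor of $t\in V$ is a neighbor $s$ of $t$ with $|s|=|t|+1$. For a finite $A\subset V$ and $\omega\in\Omega$ let $P_A^\omega$ be the finite-volume Gibbs measure of the $q$-state Potts model, $P_A^\omega(\sigma)=\frac{1}{Z_A^\omega}\exp(-E_A^\omega(\sigma))$ for $\sigma\in\{1,\dots,q\}^A$, where $$E_A^\omega(\sigma)=-J\sum_{\langle t,s\rangle:\ t,s\in A}\delta_{\sigma(t)\sigma(s)}-J\sum_{\langle t,s\rangle:\ t\in A,\ s\notin A}\delta_{\sigma(t)\omega(s)},$$ regarded as a probability measure on $\Omega$ by extending $\sigma$ by $\omega$ off $A$. Let $P^\omega$ denote the weak limit of $P^\omega_{V_n}$ as $n\to\infty$,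 when it exists. For a vector $v=(v_1,\dots,v_q)\in\mathbb R^q$ with $v_q=0$ that solves $$v_i=2\ln\frac{(\theta-1)e^{v_i}+\sum_{j=1}^{q-1}e^{v_j}+1}{\theta+\sum_{j=1}^{q-1}e^{v_j}},\qquad i=1,\dots,q-1,$$ the translation-invariant splitting Gibbs measure (TISGM) corresponding to $v$ is the unique probability measure $\mu$ on $\Omega$ such that for all $n\ge1$ and $\eta\in\{1,\dots,q\}^{V_n}$ $$\mu(\sigma|_{V_n}=\eta)=\frac1{Z_n}\exp\Big(J\sum_{\langle t,s\rangle:\ t,s\in V_n}\delta_{\eta(t)\eta(s)}+\sum_{|t|=n}v_{\eta(t)}\Big),$$ where $Z_n$ is the normalizing constant. Let $\mu_0$ be the TISGM corresponding to $v=0$ and, for $\theta\ge\theta_m$ and $i=1,2$, let $\mu_i(\theta,m)$ be the TISGM corresponding to the vector with first $m$ entries equal to $h_i(\theta,m)$ and last $q-m$ entries equal to $0$, where $$h_{1}(\theta,m)=2\ln\frac{\theta-1-\sqrt{(\theta-1)^2-4m(q-m)}}{2m},\qquad h_{2}(\theta,m)=2\ln\frac{\theta-1+\sqrt{(\theta-1)^2-4m(q-m)}}{2m}.$$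 Let $\omega\in\Omega$ be such that for every spin $l$ the number $c^l(\omega)$ of direct successors $s$ of $t$ with $\omega(s)=l$ is the same for all $t\in V\setminus\{0\}$, and such that $c^1(\omega)=\dots=c^m(\omega)$ and $c^{m+1}(\omega)=\dots=c^q(\omega)$. Put $D=c^1(\omega)-c^q(\omega)$ and $h_1=h_1(\theta,m)$. Then in each of the following cases the measures named exist, the limiting Gibbs measure $P^\omega$ exists, and: 1. If $\theta=\theta_m$, then $P^\omega=\mu_1(\theta,m)$ if $JD\ge h_1$, and $P^\omega=\mu_0$ if $JD<h_1$. 2. If $\theta_m<\theta<\theta_c$, then $P^\omega=\mu_2(\theta,m)$ if $JD>h_1$, $P^\omega=\mu_1(\theta,m)$ if $JD=h_1$, and $P^\omega=\mu_0$ if $JD<h_1$. 3. If $\theta=\theta_c$, then $P^\omega=\mu_2(\theta,m)$ if $D>0$, and $P^\omega=\mu_0$ if $D\le0$. 4. If $\theta>\theta_c$, then $P^\omega=\mu_2(\theta,m)$ if $D>0$, $P^\omega=\mu_1(\theta,m)$ if $D<0$, and $P^\omega=\mu_0$ if $D=0$. -/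

import Mathlib

open MeasureTheory Filter Topology

namespace Potts

/-! The Potts model on a locally finite graph `G` with a distinguished origin `o`.
Spins are the elements of `Fin q`: the spin `l ∈ {1, …, q}` is the element of value `l - 1`. -/

section Tree

variable {V : Type*} (G : SimpleGraph V) (o : V)

theorem finite_edist_le [G.LocallyFinite] (n : ℕ) : {t : V | G.edist o t ≤ n}.Finite := by
  classical
  induction n with
  | zero =>
    refine (Set.finite_singleton o).subset ?_
    intro t ht
    simpa using ht
  | succ n ih =>
    refine (ih.union (ih.biUnion (fun s _ => (G.neighborFinset s).finite_toSet))).subset ?_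
    intro t ht
    have ht' : G.edist t o ≤ ((n + 1 : ℕ) : ℕ∞) := by
      rw [SimpleGraph.edist_comm]; exact ht
    have hne : G.edist t o ≠ ⊤ := ne_top_of_le_ne_top (ENat.natCast_ne_top _) ht'
    obtain ⟨p, hp⟩ := SimpleGraph.exists_walk_of_edist_ne_top hne
    have hpl : p.length ≤ n + 1 := by
      rw [← hp] at ht'; exact_mod_cast ht'
    cases p with
    | nil => left; simp
    | @cons _ s _ hadj r =>
      right
      have hr : r.length ≤ n := by simpa using hpl
      have hs : G.edist o s ≤ n := by
        rw [SimpleGraph.edist_comm]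
        exact (SimpleGraph.edist_le r).trans (by exact_mod_cast hr)
      exact Set.mem_biUnion (x := s) hs (by simpa using hadj.symm)

/-- The box `V_n = {t : |t| ≤ n}`, where `|t|` is the graph distance from the origin `o`. -/
noncomputable def box [G.LocallyFinite] (n : ℕ) : Finset V :=
  (finite_edist_le G o n).toFinset

theorem mem_box [G.LocallyFinite] (hG : G.Connected) (n : ℕ) (t : V) :
    t ∈ box G o n ↔ G.dist o t ≤ n := by
  rw [box, Set.Finite.mem_toFinset, Set.mem_ofPred_eq,
    ← (hG.preconnected o t).coe_dist_eq_edist]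
  exact_mod_cast Iff.rfl

open scoped Classical in
/-- The direct successors of `t`: its neighbors that are one step farther from the origin. -/
noncomputable def directSuccessors [G.LocallyFinite] (t : V) : Finset V :=
  (G.neighborFinset t).filter (fun s => G.dist o s = G.dist o t + 1)

open scoped Classical in
/-- The number of direct successors `s` of `t` with `ω s = l`. -/
noncomputable def successorCount [G.LocallyFinite] {q : ℕ} (ω : V → Fin q) (t : V) (l : Fin q) :
    ℕ :=
  ((directSuccessors G o t).filter (fun s => ω s = l)).card

/-- `ω` belongs to the class `𝔹_m`, with `c^1(ω) = … = c^m(ω) = a` and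
`c^{m+1}(ω) = … = c^q(ω) = b`: for each spin `l`, every vertex `t` other than the origin has the
same number `c^l(ω)` of direct successors of spin `l`. -/
def InB [G.LocallyFinite] {q : ℕ} (m : ℕ) (a b : ℕ) (ω : V → Fin q) : Prop :=
  ∀ t : V, t ≠ o → ∀ l : Fin q,
    successorCount G o ω t l = if (l : ℕ) < m then a else b

end Tree

section Measures

variable {V : Type*} (G : SimpleGraph V) {q : ℕ}

open scoped Classical in
/-- The number of edges of `G` inside `A` whose two end points carry the same spin
(every edge occurs twice in the double sum). -/
noncomputable def agreeingEdges (A : Finset V) (σ : A → Fin q) : ℝ :=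
  (1 / 2) * ∑ t : A, ∑ s : A, if G.Adj (t : V) (s : V) ∧ σ t = σ s then 1 else 0

open scoped Classical in
/-- The number of edges from a vertex `t ∈ A` to a vertex `s ∉ A` with `σ t = ω s`. -/
noncomputable def agreeingBoundaryEdges [G.LocallyFinite] (A : Finset V) (ω : V → Fin q)
    (σ : A → Fin q) : ℝ :=
  ∑ t : A, ∑ s ∈ G.neighborFinset (t : V) \ A, if σ t = ω s then 1 else 0

/-- The Potts energy `E_A^ω(σ)` on `A` with boundary condition `ω`. -/
noncomputable def energy [G.LocallyFinite] (J : ℝ) (A : Finset V) (ω : V → Fin q)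
    (σ : A → Fin q) : ℝ :=
  -J * agreeingEdges G A σ - J * agreeingBoundaryEdges G A ω σ

open scoped Classical in
/-- The partition function `Z_A^ω`. -/
noncomputable def partitionFn [G.LocallyFinite] (J : ℝ) (A : Finset V) (ω : V → Fin q) : ℝ :=
  ∑ σ : A → Fin q, Real.exp (-energy G J A ω σ)

open scoped Classical in
/-- The configuration equal to `σ` on `A` and to `ω` off `A`. -/
noncomputable def glue (A : Finset V) (ω : V → Fin q) (σ : A → Fin q) : V → Fin q :=
  fun t => if h : t ∈ A then σ ⟨t, h⟩ else ω t

open scoped Classical in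
/-- The finite-volume Gibbs measure `P_A^ω`, as a measure on `Ω = {1, …, q}^V`. -/
noncomputable def gibbsMeasure [G.LocallyFinite] (J : ℝ) (A : Finset V) (ω : V → Fin q) :
    Measure (V → Fin q) :=
  ∑ σ : A → Fin q,
    ENNReal.ofReal ((partitionFn G J A ω)⁻¹ * Real.exp (-energy G J A ω σ)) •
      Measure.dirac (glue A ω σ)

open scoped Classical in
theorem partitionFn_pos [G.LocallyFinite] (J : ℝ) (A : Finset V) (ω : V → Fin q) :
    0 < partitionFn G J A ω :=
  Finset.sum_pos (fun _ _ => Real.exp_pos _) ⟨fun t => ω t, Finset.mem_univ _⟩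

open scoped Classical in
theorem isProbabilityMeasure_gibbsMeasure [G.LocallyFinite] (J : ℝ) (A : Finset V)
    (ω : V → Fin q) : IsProbabilityMeasure (gibbsMeasure G J A ω) := by
  have hZ := partitionFn_pos G J A ω
  constructor
  simp only [gibbsMeasure, Measure.coe_finsetSum, Finset.sum_apply, Measure.smul_apply,
    measure_univ, smul_eq_mul, mul_one]
  rw [← ENNReal.ofReal_sum_of_nonneg
    (fun σ _ => mul_nonneg (inv_nonneg.mpr hZ.le) (Real.exp_pos _).le), ← Finset.mul_sum]
  change ENNReal.ofReal ((partitionFn G J A ω)⁻¹ * partitionFn G J A ω) = 1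
  rw [inv_mul_cancel₀ hZ.ne', ENNReal.ofReal_one]

/-- The finite-volume Gibbs measure `P_A^ω`, as an element of the space of probability measures
on `Ω` with the topology of weak convergence. -/
noncomputable def gibbs [G.LocallyFinite] (J : ℝ) (A : Finset V) (ω : V → Fin q) :
    ProbabilityMeasure (V → Fin q) :=
  ⟨gibbsMeasure G J A ω, isProbabilityMeasure_gibbsMeasure G J A ω⟩

/-- The system of equations for the translation-invariant boundary laws on the Cayley tree of order
`k`, `h_i = k ln (((θ - 1) e^{h_i} + ∑_{j < q} e^{h_j} + 1) / (θ + ∑_{j < q} e^{h_j}))`, for vectors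
normalized by `h_q = 0`; the equation for `i = q` says exactly `h_q = 0`. -/
def IsBoundaryLaw (k : ℕ) (θ : ℝ) (h : Fin q → ℝ) : Prop :=
  ∀ i : Fin q, h i = k * Real.log
    (((θ - 1) * Real.exp (h i) + ∑ j, Real.exp (h j)) / (θ - 1 + ∑ j, Real.exp (h j)))

variable (o : V)

open scoped Classical in
/-- The unnormalized weight
`exp (J ∑_{⟨t,s⟩ ⊂ V_n} δ_{η(t) η(s)} + ∑_{|t| = n} h_{η(t)})` of `η ∈ Ω_{V_n}`. -/
noncomputable def splittingWeight [G.LocallyFinite] (J : ℝ) (h : Fin q → ℝ) (n : ℕ)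
    (η : box G o n → Fin q) : ℝ :=
  Real.exp (J * agreeingEdges G (box G o n) η +
    ∑ t : box G o n, if G.dist o (t : V) = n then h (η t) else 0)

open scoped Classical in
/-- `μ` is the translation-invariant splitting Gibbs measure (TISGM) corresponding to the
vector `h`: the vector `h` solves the boundary law equations, and for every `n ≥ 1` the marginal of
`μ` on `V_n` is `Z_n⁻¹ exp (J ∑_{⟨t,s⟩ ⊂ V_n} δ_{η(t) η(s)} + ∑_{|t| = n} h_{η(t)})`. -/
structure IsTISGM [G.LocallyFinite] (k : ℕ) (J : ℝ) (h : Fin q → ℝ)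
    (μ : ProbabilityMeasure (V → Fin q)) : Prop where
  law : IsBoundaryLaw k (Real.exp J) h
  marginal : ∀ n : ℕ, 1 ≤ n → ∀ η : box G o n → Fin q,
    (μ : Measure (V → Fin q)).real {σ | ∀ t : box G o n, σ t = η t} =
      splittingWeight G o J h n η / ∑ ξ : box G o n → Fin q, splittingWeight G o J h n ξ

/-- The limiting Gibbs measure `P^ω = w-lim P^ω_{V_n}` exists and is the TISGM corresponding to
the vector `h` (which exists and is unique). -/
def LimitIsTISGM [G.LocallyFinite] [Countable V] (k : ℕ) (J : ℝ) (ω : V → Fin q)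
    (h : Fin q → ℝ) : Prop :=
  ∃ μ : ProbabilityMeasure (V → Fin q),
    IsTISGM G o k J h μ ∧
    (∀ ν : ProbabilityMeasure (V → Fin q), IsTISGM G o k J h ν → ν = μ) ∧
    Tendsto (fun n : ℕ => gibbs G J (box G o n) ω) atTop (𝓝 μ)

end Measures

section Parameters

/-- `θ_m = 1 + 2 √(m (q - m))`. -/
noncomputable def thetaM (q m : ℕ) : ℝ := 1 + 2 * Real.sqrt (m * (q - m))

/-- `h_1(θ, m) = 2 ln ((θ - 1 - √((θ - 1)² - 4 m (q - m))) / (2 m))`. -/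
noncomputable def h1 (q m : ℕ) (θ : ℝ) : ℝ :=
  2 * Real.log ((θ - 1 - Real.sqrt ((θ - 1) ^ 2 - 4 * m * (q - m))) / (2 * m))

/-- `h_2(θ, m) = 2 ln ((θ - 1 + √((θ - 1)² - 4 m (q - m))) / (2 m))`. -/
noncomputable def h2 (q m : ℕ) (θ : ℝ) : ℝ :=
  2 * Real.log ((θ - 1 + Real.sqrt ((θ - 1) ^ 2 - 4 * m * (q - m))) / (2 * m))

/-- The vector `(x, …, x, 0, …, 0)` with `m` entries `x` and `q - m` entries `0`. -/
def hvec (q m : ℕ) (x : ℝ) : Fin q → ℝ := fun l => if (l : ℕ) < m then x else 0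

end Parameters

end Potts

/-! On a tree the vertices of a sphere are independent given their parents, so the spins of the
outermost sphere of a box can be summed out exactly. The weight exp(J·agreements + boundary field
`h`) becomes, up to a constant factor, the weight of the next smaller box with field `lawMap θ h`
(`sumOver_weight_succ`).

The boundary condition `ω` enters only through the successor counts. After removing a constant it is
the field `hvec q m (J * (a - b))` on the sphere (`neg_energy_box`). Hence the marginal of the
finite-volume measure on V_r is, with no error term, the splitting marginal with field `lawMap^[n -
r]` of that vector (`real_gibbs_cylinderBox`). The line of vectors `hvec q m x` is invariant and
carries the one-dimensional map `scalarMap` (`lawMap_hvec`), so everything reduces to the orbit of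
JD under this map.

With z = exp(x/2), the sign of x - `scalarMap` x is that of (z - 1)(z - exp(h₁/2))(z - exp(h₂/2))
(`exp_half_scalarMap_sub`). Since the map is increasing, each orbit is monotone and converges to the
first fixed point in its direction of motion. The order of 0, h₁, h₂ changes at θ = q + 1, and h₁ =
h₂ at θ_m; this yields the four cases. Cylinder convergence becomes weak convergence by compactness
of Ω, and the limit also supplies the existence of the TISGM. -/

namespace Potts

/-! ### Orbits of monotone maps of the line. -/

section Iteration

/-- Downward monotone iteration converges to the first fixed point below the starting point. -/
theorem tendsto_iterate_of_lt {f : ℝ → ℝ} (hf : Monotone f) (hc : Continuous f) {p x₀ : ℝ}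
    (hp : f p = p) (hx : p ≤ x₀) (h : ∀ x, p < x → x ≤ x₀ → f x < x) :
    Tendsto (fun n => f^[n] x₀) atTop (𝓝 p) := by
  have hle : ∀ x, p ≤ x → x ≤ x₀ → f x ≤ x := fun x h1 h2 => by
    rcases h1.eq_or_lt with rfl | h1
    · exact hp.le
    · exact (h x h1 h2).le
  have hanti : Antitone (fun n => f^[n] x₀) :=
    hf.antitone_iterate_of_map_le (hle x₀ hx le_rfl)
  have hlow : ∀ n, p ≤ f^[n] x₀ := fun n => by
    have := (hf.iterate n) hx
    rwa [Function.iterate_fixed hp] at this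
  have hbdd : BddBelow (Set.range (fun n => f^[n] x₀)) :=
    ⟨p, by rintro _ ⟨n, rfl⟩; exact hlow n⟩
  have ht := tendsto_atTop_ciInf hanti hbdd
  set l := ⨅ n, f^[n] x₀
  -- The limit of the decreasing orbit is a fixed point in [p, x₀], and `h` leaves only p.
  have hfix : f l = l := isFixedPt_of_tendsto_iterate ht hc.continuousAt
  have hpl : p ≤ l := le_ciInf hlow
  have hlx : l ≤ x₀ := ciInf_le hbdd 0
  rcases hpl.eq_or_lt with h1 | h1
  · rwa [h1]
  · exact absurd hfix (h l h1 hlx).ne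

/-- Conjugation by x ↦ -x reduces this to the decreasing case. -/
theorem tendsto_iterate_of_gt {f : ℝ → ℝ} (hf : Monotone f) (hc : Continuous f) {p x₀ : ℝ}
    (hp : f p = p) (hx : x₀ ≤ p) (h : ∀ x, x < p → x₀ ≤ x → x < f x) :
    Tendsto (fun n => f^[n] x₀) atTop (𝓝 p) := by
  have key := tendsto_iterate_of_lt (f := fun x => -f (-x)) (p := -p) (x₀ := -x₀)
    (fun x y hxy => neg_le_neg (hf (neg_le_neg hxy))) (by fun_prop) (by simp [hp])
    (neg_le_neg hx) (fun x h1 h2 => by have := h (-x) (by linarith) (by linarith); linarith)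
  have hsemi : Function.Semiconj (fun x : ℝ => -x) f (fun x => -f (-x)) := fun x => by simp
  have : (fun n => f^[n] x₀) = fun n => -((fun x => -f (-x))^[n] (-x₀)) := by
    funext n
    rw [← (hsemi.iterate_right n).eq x₀, neg_neg]
  rw [this]
  simpa using key.neg

end Iteration

/-! ### Fixed points and signs of the scalar recursion. -/

section OneDim

/-- The recursion on the class of vectors `hvec q m x`. -/
noncomputable def scalarMap (q m : ℕ) (θ x : ℝ) : ℝ :=
  2 * Real.log (((θ - 1 + m) * Real.exp x + (q - m)) / (m * Real.exp x + (θ - 1 + (q - m))))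

variable {q m : ℕ} {θ : ℝ}

theorem continuous_scalarMap (hm : 0 < m) (hmq : m ≤ q) (hθ : 1 < θ) :
    Continuous (scalarMap q m θ) := by
  have hm' : (0 : ℝ) < m := by exact_mod_cast hm
  have hq : (0 : ℝ) ≤ q - m := sub_nonneg.2 (by exact_mod_cast hmq)
  have h1 : ∀ x : ℝ, 0 < (θ - 1 + m) * Real.exp x + (q - m) := fun x => by
    have := mul_pos (by linarith : 0 < θ - 1 + m) (Real.exp_pos x); linarith
  have h2 : ∀ x : ℝ, 0 < m * Real.exp x + (θ - 1 + (q - m)) := fun x => by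
    have := mul_pos hm' (Real.exp_pos x); linarith
  unfold scalarMap
  refine continuous_const.mul (Continuous.log ?_ fun x => (div_pos (h1 x) (h2 x)).ne')
  exact Continuous.div (by fun_prop) (by fun_prop) fun x => (h2 x).ne'

theorem monotone_scalarMap (hm : 0 < m) (hmq : m ≤ q) (hθ : 1 < θ) :
    Monotone (scalarMap q m θ) := by
  have hm' : (0 : ℝ) < m := by exact_mod_cast hm
  have hq : (0 : ℝ) ≤ q - m := sub_nonneg.2 (by exact_mod_cast hmq)
  intro x y hxy
  have he := Real.exp_le_exp.2 hxy
  have hx := Real.exp_pos x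
  have hy := Real.exp_pos y
  have h1 : 0 < (θ - 1 + m) * Real.exp x + (q - m) := by
    have := mul_pos (by linarith : 0 < θ - 1 + m) hx; linarith
  have h2 : 0 < m * Real.exp x + (θ - 1 + (q - m)) := by
    have := mul_pos hm' hx; linarith
  have h3 : 0 < m * Real.exp y + (θ - 1 + (q - m)) := by
    have := mul_pos hm' hy; linarith
  unfold scalarMap
  refine mul_le_mul_of_nonneg_left (Real.log_le_log (div_pos h1 h2) ?_) zero_le_two
  rw [div_le_div_iff₀ h2 h3]
  -- The determinant of the Möbius map in exp x; it equals (θ - 1)(θ - 1 + q).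
  have hK : 0 ≤ (θ - 1 + m) * (θ - 1 + (q - m)) - m * (q - m : ℝ) := by
    nlinarith [mul_nonneg (by linarith : 0 ≤ θ - 1) hq,
      mul_nonneg (by linarith : 0 ≤ θ - 1) hm'.le, mul_self_nonneg (θ - 1)]
  nlinarith [mul_nonneg hK (sub_nonneg.2 he)]

/-- Writing the recursion in the variable `exp (x / 2)`. -/
theorem exp_half_scalarMap (hm : 0 < m) (hmq : m ≤ q) (hθ : 1 < θ) (x : ℝ) :
    Real.exp (scalarMap q m θ x / 2) =
      ((θ - 1 + m) * Real.exp (x / 2) ^ 2 + (q - m)) /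
        (m * Real.exp (x / 2) ^ 2 + (θ - 1 + (q - m))) := by
  have hm' : (0 : ℝ) < m := by exact_mod_cast hm
  have hq : (0 : ℝ) ≤ q - m := sub_nonneg.2 (by exact_mod_cast hmq)
  have hx := Real.exp_pos x
  have h1 : 0 < (θ - 1 + m) * Real.exp x + (q - m) := by
    have := mul_pos (by linarith : 0 < θ - 1 + m) hx; linarith
  have h2 : 0 < m * Real.exp x + (θ - 1 + (q - m)) := by
    have := mul_pos hm' hx; linarith
  have hsq : Real.exp (x / 2) ^ 2 = Real.exp x := by
    rw [← Real.exp_nat_mul]; congr 1; push_cast; ring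
  rw [scalarMap, mul_div_cancel_left₀ _ two_ne_zero, Real.exp_log (div_pos h1 h2), hsq]

/-- After clearing the denominator the difference is (z - 1)(m z² - (θ - 1) z + (q - m)). The
hypotheses on `u` and `v` are the Vieta relations saying that exp(u/2), exp(v/2) are the roots of
the quadratic. -/
theorem exp_half_scalarMap_sub (hm : 0 < m) (hmq : m ≤ q) (hθ : 1 < θ) {u v : ℝ}
    (hadd : m * (Real.exp (u / 2) + Real.exp (v / 2)) = θ - 1)
    (hmul : m * (Real.exp (u / 2) * Real.exp (v / 2)) = q - m) (x : ℝ) :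
    ∃ K > 0, Real.exp (x / 2) - Real.exp (scalarMap q m θ x / 2) =
      K * ((Real.exp (x / 2) - Real.exp (0 / 2)) * (Real.exp (x / 2) - Real.exp (u / 2)) *
        (Real.exp (x / 2) - Real.exp (v / 2))) := by
  have hm' : (0 : ℝ) < m := by exact_mod_cast hm
  have hq : (0 : ℝ) ≤ q - m := sub_nonneg.2 (by exact_mod_cast hmq)
  rw [exp_half_scalarMap hm hmq hθ]
  set z := Real.exp (x / 2)
  have hz : 0 < z := Real.exp_pos _
  have h2 : 0 < m * z ^ 2 + (θ - 1 + (q - m)) := by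
    have := mul_pos hm' (pow_pos hz 2); linarith
  refine ⟨m / (m * z ^ 2 + (θ - 1 + (q - m))), div_pos hm' h2, ?_⟩
  rw [zero_div, Real.exp_zero]
  rw [div_mul_eq_mul_div, eq_div_iff h2.ne', sub_mul, div_mul_cancel₀ _ h2.ne']
  linear_combination (z ^ 2 - z) * hadd - (z - 1) * hmul

theorem scalarMap_lt (hm : 0 < m) (hmq : m ≤ q) (hθ : 1 < θ) {u v : ℝ}
    (hadd : m * (Real.exp (u / 2) + Real.exp (v / 2)) = θ - 1)
    (hmul : m * (Real.exp (u / 2) * Real.exp (v / 2)) = q - m) {x : ℝ}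
    (h : 0 < (Real.exp (x / 2) - Real.exp (0 / 2)) * (Real.exp (x / 2) - Real.exp (u / 2)) *
        (Real.exp (x / 2) - Real.exp (v / 2))) : scalarMap q m θ x < x := by
  obtain ⟨K, hK, he⟩ := exp_half_scalarMap_sub hm hmq hθ hadd hmul x
  have := mul_pos hK h
  rw [← he, sub_pos, Real.exp_lt_exp] at this
  linarith

theorem lt_scalarMap (hm : 0 < m) (hmq : m ≤ q) (hθ : 1 < θ) {u v : ℝ}
    (hadd : m * (Real.exp (u / 2) + Real.exp (v / 2)) = θ - 1)
    (hmul : m * (Real.exp (u / 2) * Real.exp (v / 2)) = q - m) {x : ℝ}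
    (h : (Real.exp (x / 2) - Real.exp (0 / 2)) * (Real.exp (x / 2) - Real.exp (u / 2)) *
        (Real.exp (x / 2) - Real.exp (v / 2)) < 0) : x < scalarMap q m θ x := by
  obtain ⟨K, hK, he⟩ := exp_half_scalarMap_sub hm hmq hθ hadd hmul x
  have := mul_neg_of_pos_of_neg hK h
  rw [← he, sub_neg, Real.exp_lt_exp] at this
  linarith

theorem scalarMap_eq (hm : 0 < m) (hmq : m ≤ q) (hθ : 1 < θ) {u v : ℝ}
    (hadd : m * (Real.exp (u / 2) + Real.exp (v / 2)) = θ - 1)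
    (hmul : m * (Real.exp (u / 2) * Real.exp (v / 2)) = q - m) {x : ℝ}
    (h : x = 0 ∨ x = u ∨ x = v) : scalarMap q m θ x = x := by
  obtain ⟨K, hK, he⟩ := exp_half_scalarMap_sub hm hmq hθ hadd hmul x
  have h0 : Real.exp (x / 2) - Real.exp (scalarMap q m θ x / 2) = 0 := by
    rw [he]; rcases h with rfl | rfl | rfl <;> simp
  rw [sub_eq_zero, Real.exp_eq_exp] at h0
  linarith

theorem exp_half_sub_pos {x y : ℝ} (h : y < x) : 0 < Real.exp (x / 2) - Real.exp (y / 2) :=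
  sub_pos.2 (Real.exp_lt_exp.2 (by linarith))

theorem exp_half_sub_neg {x y : ℝ} (h : x < y) : Real.exp (x / 2) - Real.exp (y / 2) < 0 :=
  sub_neg.2 (Real.exp_lt_exp.2 (by linarith))

end OneDim

/-! ### Vieta relations for h₁, h₂ and their position relative to 0. -/

section Parameters

variable {q m : ℕ} {θ : ℝ}

theorem exp_half_h1_h2 (hm : 1 ≤ m) (hmq : m ≤ q / 2) (hθ : thetaM q m ≤ θ) :
    m * (Real.exp (h1 q m θ / 2) + Real.exp (h2 q m θ / 2)) = θ - 1 ∧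
      m * (Real.exp (h1 q m θ / 2) * Real.exp (h2 q m θ / 2)) = q - m ∧
      m * (Real.exp (h2 q m θ / 2) - Real.exp (h1 q m θ / 2)) =
        Real.sqrt ((θ - 1) ^ 2 - 4 * m * (q - m)) := by
  have hm' : (0 : ℝ) < m := by exact_mod_cast hm
  have hmq' : (m : ℝ) + m ≤ q := by exact_mod_cast (by omega : m + m ≤ q)
  have hmm : 0 < (m : ℝ) * (q - m) := mul_pos hm' (by linarith)
  have hs := Real.sq_sqrt hmm.le
  have hs0 := Real.sqrt_pos.2 hmm
  unfold thetaM at hθ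
  have hd : 0 ≤ (θ - 1) ^ 2 - 4 * m * (q - m) := by nlinarith
  have hr := Real.sq_sqrt hd
  have hr0 := Real.sqrt_nonneg ((θ - 1) ^ 2 - 4 * m * (q - m))
  have hlt : Real.sqrt ((θ - 1) ^ 2 - 4 * m * (q - m)) < θ - 1 := by
    rw [Real.sqrt_lt' (by linarith)]; nlinarith
  unfold h1 h2
  set r := Real.sqrt ((θ - 1) ^ 2 - 4 * m * (q - m))
  rw [mul_div_cancel_left₀ _ two_ne_zero, mul_div_cancel_left₀ _ two_ne_zero,
    Real.exp_log (div_pos (by linarith) (by linarith)),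
    Real.exp_log (div_pos (by linarith) (by linarith))]
  refine ⟨by field_simp; ring, ?_, by field_simp; ring⟩
  field_simp
  linear_combination -hr

theorem h1_le_h2 (hm : 1 ≤ m) (hmq : m ≤ q / 2) (hθ : thetaM q m ≤ θ) :
    h1 q m θ ≤ h2 q m θ := by
  have hm' : (0 : ℝ) < m := by exact_mod_cast hm
  obtain ⟨-, -, h⟩ := exp_half_h1_h2 hm hmq hθ
  have : 0 ≤ Real.exp (h2 q m θ / 2) - Real.exp (h1 q m θ / 2) :=
    nonneg_of_mul_nonneg_right (h ▸ Real.sqrt_nonneg _) hm'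
  rw [sub_nonneg, Real.exp_le_exp] at this
  linarith

theorem thetaM_le (hm : 1 ≤ m) (hmq : m ≤ q / 2) : thetaM q m ≤ q + 1 := by
  have hm' : (0 : ℝ) < m := by exact_mod_cast hm
  have hmq' : (m : ℝ) + m ≤ q := by exact_mod_cast (by omega : m + m ≤ q)
  have : Real.sqrt (m * (q - m)) ≤ q / 2 := by
    rw [Real.sqrt_le_left (by linarith)]; nlinarith [sq_nonneg ((q : ℝ) - 2 * m)]
  unfold thetaM; linarith

theorem h1_eq_h2 (hm : 1 ≤ m) (hmq : m ≤ q / 2) (hθ : θ = thetaM q m) :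
    h1 q m θ = h2 q m θ := by
  have hm' : (0 : ℝ) < m := by exact_mod_cast hm
  have hmq' : (m : ℝ) + m ≤ q := by exact_mod_cast (by omega : m + m ≤ q)
  have hs := Real.sq_sqrt (mul_pos hm' (by linarith : (0 : ℝ) < q - m)).le
  have : (θ - 1) ^ 2 - 4 * m * (q - m) = 0 := by
    rw [hθ, thetaM]; linear_combination 4 * hs
  simp [h1, h2, this]

/-- For the roots y ≤ z, Vieta gives m(y - 1)(z - 1) = q + 1 - θ ≥ 0, so 1 is not strictly between
them. Both cannot lie below 1 either, because yz = (q - m)/m ≥ 1. -/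
theorem h1_nonneg (hm : 1 ≤ m) (hmq : m ≤ q / 2) (hθ : thetaM q m ≤ θ) (hq : θ ≤ q + 1) :
    0 ≤ h1 q m θ := by
  have hm' : (0 : ℝ) < m := by exact_mod_cast hm
  have hmq' : (m : ℝ) + m ≤ q := by exact_mod_cast (by omega : m + m ≤ q)
  obtain ⟨ha, hp, -⟩ := exp_half_h1_h2 hm hmq hθ
  have hle := Real.exp_le_exp.2 (div_le_div_of_nonneg_right (h1_le_h2 hm hmq hθ) zero_le_two)
  set y := Real.exp (h1 q m θ / 2) with hy
  set z := Real.exp (h2 q m θ / 2)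
  have h1' : 1 ≤ y := by
    by_contra! hlt
    have hy0 : 0 < y := Real.exp_pos _
    have hz : 1 < z := by
      by_contra! hz
      nlinarith [mul_pos hm' hy0]
    have : 0 < m * ((1 - y) * (z - 1)) := by
      have h1 := sub_pos.2 hlt
      have h2 := sub_pos.2 hz
      positivity
    nlinarith
  rw [hy, Real.one_le_exp_iff] at h1'
  linarith

theorem h1_pos (hm : 1 ≤ m) (hmq : m ≤ q / 2) (hθ : thetaM q m ≤ θ) (hq : θ < q + 1) :
    0 < h1 q m θ := by
  refine (h1_nonneg hm hmq hθ hq.le).lt_of_ne fun h0 => ?_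
  obtain ⟨ha, hp, -⟩ := exp_half_h1_h2 hm hmq hθ
  rw [← h0] at ha hp
  simp at ha hp
  linarith

theorem h1_eq_zero (hm : 1 ≤ m) (hmq : m ≤ q / 2) (hq : θ = q + 1) : h1 q m θ = 0 := by
  have hmq' : (m : ℝ) + m ≤ q := by exact_mod_cast (by omega : m + m ≤ q)
  have hm' : (0 : ℝ) < m := by exact_mod_cast hm
  have : (θ - 1) ^ 2 - 4 * m * (q - m) = ((q : ℝ) - 2 * m) ^ 2 := by rw [hq]; ring
  rw [h1, this, Real.sqrt_sq (by linarith), hq,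
    show ((q : ℝ) + 1 - 1 - (q - 2 * m)) = 2 * m by ring, div_self (by positivity)]
  simp

/-- Here m(y - 1)(z - 1) = q + 1 - θ is negative, so 1 separates the two roots. -/
theorem h1_neg_h2_pos (hm : 1 ≤ m) (hmq : m ≤ q / 2) (hq : q + 1 < θ) :
    h1 q m θ < 0 ∧ 0 < h2 q m θ := by
  have hm' : (0 : ℝ) < m := by exact_mod_cast hm
  have hθ : thetaM q m ≤ θ := (thetaM_le hm hmq).trans hq.le
  obtain ⟨ha, hp, -⟩ := exp_half_h1_h2 hm hmq hθ
  have hle := Real.exp_le_exp.2 (div_le_div_of_nonneg_right (h1_le_h2 hm hmq hθ) zero_le_two)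
  set y := Real.exp (h1 q m θ / 2) with hy
  set z := Real.exp (h2 q m θ / 2) with hz
  have hprod : (y - 1) * (z - 1) < 0 := by
    by_contra! h
    have := mul_nonneg hm'.le h
    nlinarith
  have h1' : y < 1 := by
    by_contra! h
    nlinarith [mul_nonneg (sub_nonneg.2 h) (sub_nonneg.2 (h.trans hle))]
  have h2' : 1 < z := by
    by_contra! h
    nlinarith [mul_nonneg (sub_nonneg.2 h1'.le) (sub_nonneg.2 h)]
  rw [hy, Real.exp_lt_one_iff] at h1'
  rw [hz, Real.one_lt_exp_iff] at h2'
  constructor <;> linarith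

end Parameters
end Potts

namespace Potts

/-! ### Parents, successors and spheres in a rooted tree. -/

section TreeStructure

open scoped Classical

variable {V : Type*} {G : SimpleGraph V} {o : V}

/-- Geodesics to `t` and `t'` extended by one edge are both paths from `o` to `s`; a tree has only
one. -/
theorem eq_of_adj_of_dist_eq (hG : G.IsTree) {s t t' : V} (h : G.Adj t s) (h' : G.Adj t' s)
    (hd : G.dist o s = G.dist o t + 1) (hd' : G.dist o s = G.dist o t' + 1) : t = t' := by
  obtain ⟨p, -, hpl⟩ := hG.connected.exists_path_of_dist o t
  obtain ⟨p', -, hpl'⟩ := hG.connected.exists_path_of_dist o t'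
  have h1 := (p.concat h).isPath_of_length_eq_dist (by rw [SimpleGraph.Walk.length_concat]; omega)
  have h2 := (p'.concat h').isPath_of_length_eq_dist
    (by rw [SimpleGraph.Walk.length_concat]; omega)
  exact (SimpleGraph.Walk.concat_inj ((hG.existsUnique_path o s).unique h1 h2)).1

theorem exists_adj_dist_eq (hG : G.IsTree) {s : V} (hs : s ≠ o) :
    ∃ t, G.Adj t s ∧ G.dist o s = G.dist o t + 1 := by
  obtain ⟨p, hp⟩ := hG.connected.exists_walk_length_eq_dist s o
  cases p with
  | nil => exact absurd rfl hs
  | @cons _ t _ h r =>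
    refine ⟨t, h.symm, ?_⟩
    have h1 := G.dist_le r
    rw [SimpleGraph.Walk.length_cons] at hp
    have h2 := hG.dist_eq_dist_add_one_of_adj o h
    rw [G.dist_comm] at h1 hp
    omega

variable (G o) in
/-- The neighbor of `s` that is closer to the origin. -/
noncomputable def parent (s : V) : V :=
  if h : ∃ t, G.Adj t s ∧ G.dist o s = G.dist o t + 1 then h.choose else s

theorem parent_spec (hG : G.IsTree) {s : V} (hs : s ≠ o) :
    G.Adj (parent G o s) s ∧ G.dist o s = G.dist o (parent G o s) + 1 := by
  have h := exists_adj_dist_eq hG hs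
  rw [parent, dif_pos h]
  exact h.choose_spec

variable [G.LocallyFinite]

theorem mem_directSuccessors {s t : V} :
    s ∈ directSuccessors G o t ↔ G.Adj t s ∧ G.dist o s = G.dist o t + 1 := by
  simp [directSuccessors]

/-- The condition `s ≠ o` cannot be dropped, since `parent` sends `o` to itself by default. -/
theorem mem_directSuccessors_iff_parent (hG : G.IsTree) {s t : V} :
    s ∈ directSuccessors G o t ↔ s ≠ o ∧ parent G o s = t := by
  rw [mem_directSuccessors]
  constructor
  · rintro ⟨h1, h2⟩
    have hs : s ≠ o := by rintro rfl; simp at h2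
    have := parent_spec hG hs
    exact ⟨hs, eq_of_adj_of_dist_eq hG this.1 h1 this.2 h2⟩
  · rintro ⟨hs, rfl⟩
    exact parent_spec hG hs

theorem card_directSuccessors (hG : G.IsTree) (hdeg : G.IsRegularOfDegree 3) {t : V}
    (ht : t ≠ o) : (directSuccessors G o t).card = 2 := by
  have hp := parent_spec hG ht
  have : directSuccessors G o t = (G.neighborFinset t).erase (parent G o t) := by
    ext s
    simp only [mem_directSuccessors, Finset.mem_erase, SimpleGraph.mem_neighborFinset]
    constructor
    · rintro ⟨h1, h2⟩
      refine ⟨?_, h1⟩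
      rintro rfl
      omega
    · rintro ⟨h1, h2⟩
      refine ⟨h2, (hG.dist_eq_dist_add_one_of_adj o h2).resolve_left fun h3 => h1 ?_⟩
      exact eq_of_adj_of_dist_eq hG h2.symm hp.1 h3 hp.2
  rw [this, Finset.card_erase_of_mem (by simpa using hp.1.symm),
    SimpleGraph.card_neighborFinset_eq_degree, hdeg t]

variable (G o) in
/-- The sphere of radius `n` around the origin. -/
noncomputable def sphere (n : ℕ) : Finset V := (box G o n).filter (fun t => G.dist o t = n)

theorem mem_sphere (hG : G.IsTree) {n : ℕ} {t : V} : t ∈ sphere G o n ↔ G.dist o t = n := by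
  simp only [sphere, Finset.mem_filter, mem_box G o hG.connected]
  omega

theorem ne_of_mem_sphere (hG : G.IsTree) {n : ℕ} (hn : 1 ≤ n) {t : V} (ht : t ∈ sphere G o n) :
    t ≠ o := by
  rintro rfl
  rw [mem_sphere hG, G.dist_self] at ht
  omega

theorem box_succ (hG : G.IsTree) (n : ℕ) :
    box G o (n + 1) = box G o n ∪ sphere G o (n + 1) := by
  ext t
  simp only [Finset.mem_union, mem_box G o hG.connected, mem_sphere hG]
  omega

theorem disjoint_box_sphere (hG : G.IsTree) (n : ℕ) :
    Disjoint (box G o n) (sphere G o (n + 1)) := by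
  rw [Finset.disjoint_left]
  intro t
  simp only [mem_box G o hG.connected, mem_sphere hG]
  omega

theorem box_mono (hG : G.IsTree) {r n : ℕ} (h : r ≤ n) : box G o r ⊆ box G o n := by
  intro t
  simp only [mem_box G o hG.connected]
  omega

theorem filter_parent_eq (hG : G.IsTree) {n : ℕ} {t : V} (ht : t ∈ sphere G o n) :
    (sphere G o (n + 1)).filter (fun s => parent G o s = t) = directSuccessors G o t := by
  rw [mem_sphere hG] at ht
  ext s
  simp only [Finset.mem_filter, mem_sphere hG]
  constructor
  · rintro ⟨h1, h2⟩
    exact (mem_directSuccessors_iff_parent hG).2 ⟨by rintro rfl; simp at h1, h2⟩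
  · intro h
    exact ⟨by rw [(mem_directSuccessors.1 h).2, ht],
      ((mem_directSuccessors_iff_parent hG).1 h).2⟩

theorem parent_mem_sphere (hG : G.IsTree) {n : ℕ} {s : V} (hs : s ∈ sphere G o (n + 1)) :
    parent G o s ∈ sphere G o n := by
  have := parent_spec hG (ne_of_mem_sphere hG (by omega) hs)
  rw [mem_sphere hG] at hs ⊢
  omega

/-- Group the factors by parent: away from the origin each fibre has two elements. The origin has
three successors, hence `1 ≤ n`. -/
theorem prod_sphere_succ (hG : G.IsTree) (hdeg : G.IsRegularOfDegree 3) {n : ℕ} (hn : 1 ≤ n)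
    (f : V → ℝ) :
    ∏ s ∈ sphere G o (n + 1), f (parent G o s) = ∏ t ∈ sphere G o n, f t ^ 2 := by
  rw [← Finset.prod_fiberwise_of_maps_to (fun s hs => parent_mem_sphere hG hs)]
  refine Finset.prod_congr rfl fun t ht => ?_
  rw [filter_parent_eq hG ht, ← card_directSuccessors hG hdeg (ne_of_mem_sphere hG hn ht),
    ← Finset.prod_const]
  refine Finset.prod_congr rfl fun s hs => ?_
  rw [((mem_directSuccessors_iff_parent hG).1 hs).2]

/-- A vertex of `box n` has neighbors outside `box n` only if it is on the sphere; these are its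
direct successors. -/
theorem neighborFinset_sdiff_box (hG : G.IsTree) {n : ℕ} {t : V} (ht : t ∈ box G o n) :
    G.neighborFinset t \ box G o n =
      if t ∈ sphere G o n then directSuccessors G o t else ∅ := by
  rw [mem_box G o hG.connected] at ht
  ext s
  simp only [Finset.mem_sdiff, SimpleGraph.mem_neighborFinset, mem_box G o hG.connected,
    mem_sphere hG]
  split_ifs with h
  · rw [mem_directSuccessors]
    refine and_congr_right fun hadj => ?_
    have := hG.dist_eq_dist_add_one_of_adj o hadj
    omega
  · simp only [Finset.notMem_empty, iff_false, not_and, not_not]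
    intro hadj
    have := hG.dist_eq_dist_add_one_of_adj o hadj
    omega

end TreeStructure

/-! ### Summation over the spins of a finite set. -/

section PartialSums

open scoped Classical

variable {V : Type*} {q : ℕ}

/-- The sum of `f` over all changes of the configuration `σ` in `A`. -/
noncomputable def sumOver (A : Finset V) (f : (V → Fin q) → ℝ) (σ : V → Fin q) : ℝ :=
  ∑ ζ : A → Fin q, f (glue A σ ζ)

theorem sumOver_union {A B : Finset V} (h : Disjoint A B) (f : (V → Fin q) → ℝ)
    (σ : V → Fin q) : sumOver (A ∪ B) f σ = sumOver A (sumOver B f) σ := by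
  unfold sumOver
  rw [← Fintype.sum_prod_type' (f := fun y z => f (glue B (glue A σ y) z))]
  refine (Fintype.sum_equiv (Equiv.piFinsetUnion (fun _ => Fin q) h) _ _ ?_).symm
  rintro ⟨y, z⟩
  -- `glue` is `Function.updateFinset` by unfolding, so two disjoint updates merge into one.
  exact congrArg f (Function.updateFinset_updateFinset h)

theorem sumOver_empty (f : (V → Fin q) → ℝ) (σ : V → Fin q) : sumOver ∅ f σ = f σ := by
  unfold sumOver
  rw [Fintype.sum_unique]
  exact congrArg f (by funext t; simp [glue])

theorem sumOver_const_mul (A : Finset V) (c : ℝ) (f : (V → Fin q) → ℝ) (σ : V → Fin q) :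
    sumOver A (fun τ => c * f τ) σ = c * sumOver A f σ := by
  unfold sumOver
  rw [Finset.mul_sum]

theorem glue_apply_of_mem {A : Finset V} (σ : V → Fin q) (ζ : A → Fin q) {t : V} (ht : t ∈ A) :
    glue A σ ζ t = ζ ⟨t, ht⟩ := by simp [glue, ht]

theorem glue_apply_of_notMem {A : Finset V} (σ : V → Fin q) (ζ : A → Fin q) {t : V}
    (ht : t ∉ A) : glue A σ ζ t = σ t := by simp [glue, ht]

theorem glue_apply_coe {A : Finset V} (σ : V → Fin q) (ζ : A → Fin q) (t : A) :
    glue A σ ζ t = ζ t := glue_apply_of_mem σ ζ t.2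

end PartialSums

/-! ### Summing out spheres transforms the boundary field. -/

section Weights

open scoped Classical

variable {V : Type*} {G : SimpleGraph V} {o : V} {q : ℕ}

variable (G) in
/-- The number of edges in `A` with equal spins, as a function of the full configuration. -/
noncomputable def agree (A : Finset V) (σ : V → Fin q) : ℝ :=
  (1 / 2) * ∑ t ∈ A, ∑ s ∈ A, if G.Adj t s ∧ σ t = σ s then 1 else 0

theorem agreeingEdges_eq_agree (A : Finset V) (σ : V → Fin q) (ζ : A → Fin q) :
    agreeingEdges G A ζ = agree G A (glue A σ ζ) := by
  unfold agreeingEdges agree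
  congr 1
  rw [← Finset.sum_coe_sort A]
  refine Finset.sum_congr rfl fun t _ => ?_
  rw [← Finset.sum_coe_sort A]
  refine Finset.sum_congr rfl fun s _ => ?_
  rw [glue_apply_coe, glue_apply_coe]

theorem agree_congr {A : Finset V} {σ τ : V → Fin q} (h : ∀ t ∈ A, σ t = τ t) :
    agree G A σ = agree G A τ := by
  unfold agree
  congr 1
  refine Finset.sum_congr rfl fun t ht => Finset.sum_congr rfl fun s hs => ?_
  rw [h t ht, h s hs]

variable [G.LocallyFinite]

/-- A tree has no edge inside a sphere, so each new vertex adds only the edge to its parent. The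
double sum sees that edge twice, which cancels the factor 1/2. -/
theorem agree_box_succ (hG : G.IsTree) (n : ℕ) (σ : V → Fin q) :
    agree G (box G o (n + 1)) σ = agree G (box G o n) σ +
      ∑ s ∈ sphere G o (n + 1), if σ (parent G o s) = σ s then 1 else 0 := by
  set k : V → V → ℝ := fun t s => if G.Adj t s ∧ σ t = σ s then 1 else 0 with hk
  have hsymm : ∀ t s, k t s = k s t := fun t s => by
    simp only [hk, G.adj_comm t s, eq_comm (a := σ t)]
  have hcross : ∑ t ∈ box G o n, ∑ s ∈ sphere G o (n + 1), k t s =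
      ∑ s ∈ sphere G o (n + 1), if σ (parent G o s) = σ s then 1 else 0 := by
    rw [Finset.sum_comm]
    refine Finset.sum_congr rfl fun s hs => ?_
    have hp := parent_spec hG (ne_of_mem_sphere hG (by omega) hs)
    have hs' := (mem_sphere hG).1 hs
    rw [Finset.sum_eq_single (parent G o s)]
    · simp [hk, hp.1]
    · intro t ht hne
      rw [mem_box G o hG.connected] at ht
      simp only [hk, ite_eq_right_iff, and_imp]
      intro hadj _
      refine absurd (eq_of_adj_of_dist_eq hG hadj hp.1 ?_ hp.2) hne
      have := hG.dist_eq_dist_add_one_of_adj o hadj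
      omega
    · intro h
      rw [mem_box G o hG.connected] at h
      omega
  have hin : ∑ t ∈ sphere G o (n + 1), ∑ s ∈ sphere G o (n + 1), k t s = 0 := by
    refine Finset.sum_eq_zero fun t ht => Finset.sum_eq_zero fun s hs => ?_
    rw [mem_sphere hG] at ht hs
    simp only [hk, ite_eq_right_iff, and_imp]
    intro hadj
    exact absurd (ht.trans hs.symm) (hG.dist_ne_of_adj o hadj)
  have hd := disjoint_box_sphere (o := o) hG n
  change 1 / 2 * ∑ t ∈ box G o (n + 1), ∑ s ∈ box G o (n + 1), k t s =
    1 / 2 * ∑ t ∈ box G o n, ∑ s ∈ box G o n, k t s + _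
  rw [box_succ hG, Finset.sum_union hd]
  simp only [Finset.sum_union hd, Finset.sum_add_distrib]
  rw [hin, Finset.sum_comm (s := sphere G o (n + 1)) (t := box G o n)]
  have hcross' : ∑ t ∈ box G o n, ∑ s ∈ sphere G o (n + 1), k s t =
      ∑ t ∈ box G o n, ∑ s ∈ sphere G o (n + 1), k t s :=
    Finset.sum_congr rfl fun t _ => Finset.sum_congr rfl fun s _ => hsymm s t
  linarith

variable (G o) in
/-- The weight of `splittingWeight`, as a function of the full configuration. -/
noncomputable def weight (J : ℝ) (h : Fin q → ℝ) (n : ℕ) (σ : V → Fin q) : ℝ :=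
  Real.exp (J * agree G (box G o n) σ + ∑ t ∈ sphere G o n, h (σ t))

theorem splittingWeight_eq_weight (J : ℝ) (h : Fin q → ℝ) (n : ℕ) (σ : V → Fin q)
    (η : box G o n → Fin q) :
    splittingWeight G o J h n η = weight G o J h n (glue (box G o n) σ η) := by
  unfold splittingWeight weight
  rw [agreeingEdges_eq_agree _ σ, sphere, Finset.sum_filter, ← Finset.sum_coe_sort (box G o n)]
  simp only [glue_apply_coe]

/-- The map of boundary laws obtained by summing over the spins of one sphere. -/
noncomputable def lawMap (θ : ℝ) (h : Fin q → ℝ) (i : Fin q) : ℝ :=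
  2 * Real.log (((θ - 1) * Real.exp (h i) + ∑ j, Real.exp (h j)) /
    (θ - 1 + ∑ j, Real.exp (h j)))

theorem sum_exp_agree (J : ℝ) (h : Fin q → ℝ) (i : Fin q) :
    ∑ l, Real.exp (J * (if i = l then 1 else 0) + h l) =
      (Real.exp J - 1) * Real.exp (h i) + ∑ j, Real.exp (h j) := by
  have : ∀ l, Real.exp (J * (if i = l then 1 else 0) + h l) =
      (if i = l then (Real.exp J - 1) * Real.exp (h l) else 0) + Real.exp (h l) := fun l => by
    split_ifs
    · rw [mul_one, Real.exp_add]; ring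
    · simp
  simp only [this, Finset.sum_add_distrib, Finset.sum_ite_eq, Finset.mem_univ, if_true]

/-- Given the inner configuration, the sum factorizes over the new vertices, and each factor depends
only on the spin of the parent. Two children per parent square it, which is the 2 in `lawMap`. -/
theorem sumOver_weight_succ (hG : G.IsTree) (hdeg : G.IsRegularOfDegree 3) {J : ℝ} (hJ : 0 < J)
    (h : Fin q → ℝ) {n : ℕ} (hn : 1 ≤ n) :
    ∃ C > 0, ∀ σ : V → Fin q, sumOver (sphere G o (n + 1)) (weight G o J h (n + 1)) σ =
      C * weight G o J (lawMap (Real.exp J) h) n σ := by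
  have hS : 0 ≤ ∑ j, Real.exp (h j) := Finset.sum_nonneg fun j _ => (Real.exp_pos _).le
  have hθ : 0 < Real.exp J - 1 := sub_pos.2 (Real.one_lt_exp_iff.2 hJ)
  set c := Real.exp J - 1 + ∑ j, Real.exp (h j) with hc
  have hcpos : 0 < c := by linarith
  -- `c` is the denominator in `lawMap`, independent of the spin; each vertex of the inner sphere
  -- releases one `c ^ 2`.
  refine ⟨(c ^ 2) ^ (sphere G o n).card, by positivity, fun σ => ?_⟩
  set S := sphere G o (n + 1)
  have hpS : ∀ s ∈ S, parent G o s ∉ S := fun s hs h1 => by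
    have h2 := (mem_sphere hG).1 (parent_mem_sphere hG hs)
    have h3 := (mem_sphere hG).1 h1
    omega
  have hW : ∀ ζ : S → Fin q, weight G o J h (n + 1) (glue S σ ζ) =
      Real.exp (J * agree G (box G o n) σ) * ∏ s : S,
        Real.exp (J * (if σ (parent G o s) = ζ s then 1 else 0) + h (ζ s)) := fun ζ => by
    unfold weight
    rw [agree_box_succ hG, agree_congr (τ := σ) fun t ht => glue_apply_of_notMem σ ζ
      (Finset.disjoint_left.1 (disjoint_box_sphere hG n) ht), ← Real.exp_sum, ← Real.exp_add,
      ← Finset.sum_coe_sort S, ← Finset.sum_coe_sort S, Finset.sum_add_distrib,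
      ← Finset.mul_sum]
    congr 1
    simp only [glue_apply_coe]
    rw [mul_add, add_assoc]
    congr 3
    refine Finset.sum_congr rfl fun s _ => ?_
    rw [glue_apply_of_notMem σ ζ (hpS s s.2)]
  unfold sumOver
  simp only [hW]
  rw [← Finset.mul_sum]
  -- A sum over configurations of a product of one-site terms is the product of the one-site sums.
  have hprod := Finset.prod_univ_sum (fun _ : S => (Finset.univ : Finset (Fin q)))
    (fun s l => Real.exp (J * (if σ (parent G o s) = l then 1 else 0) + h l))
  rw [Fintype.piFinset_univ] at hprod
  rw [← hprod]
  simp only [sum_exp_agree]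
  rw [Finset.prod_coe_sort S (fun s => (Real.exp J - 1) * Real.exp (h (σ (parent G o s))) +
    ∑ j, Real.exp (h j)), prod_sphere_succ hG hdeg hn (fun t => (Real.exp J - 1) *
      Real.exp (h (σ t)) + ∑ j, Real.exp (h j))]
  have hΦ : ∀ i, ((Real.exp J - 1) * Real.exp (h i) + ∑ j, Real.exp (h j)) ^ 2 =
      c ^ 2 * Real.exp (lawMap (Real.exp J) h i) := fun i => by
    have hpos : 0 < (Real.exp J - 1) * Real.exp (h i) + ∑ j, Real.exp (h j) := by
      have := mul_pos hθ (Real.exp_pos (h i)); linarith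
    rw [lawMap, ← Nat.cast_two (R := ℝ), Real.exp_nat_mul, ← hc,
      Real.exp_log (div_pos hpos hcpos), div_pow, mul_div_cancel₀]
    positivity
  simp only [hΦ]
  rw [Finset.prod_mul_distrib, Finset.prod_const, ← Real.exp_sum, weight, Real.exp_add]
  ring

/-- Spheres are peeled off from the outside. The field changes at each step, so the induction runs
over all `h`. -/
theorem sumOver_weight_sdiff (hG : G.IsTree) (hdeg : G.IsRegularOfDegree 3) {J : ℝ} (hJ : 0 < J)
    {r : ℕ} (hr : 1 ≤ r) (d : ℕ) (h : Fin q → ℝ) :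
    ∃ C > 0, ∀ σ : V → Fin q,
      sumOver (box G o (r + d) \ box G o r) (weight G o J h (r + d)) σ =
        C * weight G o J ((lawMap (Real.exp J))^[d] h) r σ := by
  induction d generalizing h with
  | zero =>
    refine ⟨1, one_pos, fun σ => ?_⟩
    simp [sumOver_empty]
  | succ d ih =>
    obtain ⟨C, hC, hC'⟩ := sumOver_weight_succ (o := o) hG hdeg hJ h (n := r + d) (by omega)
    obtain ⟨C', hC1, hC2⟩ := ih (lawMap (Real.exp J) h)
    refine ⟨C * C', mul_pos hC hC1, fun σ => ?_⟩
    have hd := disjoint_box_sphere (o := o) hG (r + d)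
    have hset : box G o (r + (d + 1)) \ box G o r =
        (box G o (r + d) \ box G o r) ∪ sphere G o (r + d + 1) := by
      rw [← add_assoc, box_succ hG, Finset.union_sdiff_distrib, Finset.sdiff_eq_self_of_disjoint
        ((hd.mono_left (box_mono hG (by omega))).symm)]
    rw [hset, sumOver_union (hd.mono_left Finset.sdiff_subset), Function.iterate_succ_apply,
      mul_assoc, ← hC2, ← sumOver_const_mul]
    exact congrArg (fun f => sumOver _ f σ) (funext hC')

end Weights
end Potts

namespace Potts

/-! ### Finite-volume marginals and weak convergence. -/

section Cylinders

open scoped Classical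

variable {V : Type*} {G : SimpleGraph V} {o : V} {q : ℕ} [G.LocallyFinite]

/-- A sphere vertex has `a` or `b` agreeing successors according to its spin. Taking out the common
`b` leaves a field that vanishes on the last q - m spins. -/
theorem neg_energy_box (hG : G.IsTree) (J : ℝ) {n m a b : ℕ} (hn : 1 ≤ n) {ω : V → Fin q}
    (hω : InB G o m a b ω) (ζ : box G o n → Fin q) :
    -energy G J (box G o n) ω ζ = J * b * (sphere G o n).card +
      (J * agree G (box G o n) (glue (box G o n) ω ζ) +
        ∑ t ∈ sphere G o n, hvec q m (J * (a - b)) (glue (box G o n) ω ζ t)) := by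
  have hb : agreeingBoundaryEdges G (box G o n) ω ζ =
      ∑ t ∈ sphere G o n, (successorCount G o ω t (glue (box G o n) ω ζ t) : ℝ) := by
    unfold agreeingBoundaryEdges
    rw [sphere, Finset.sum_filter, ← Finset.sum_coe_sort (box G o n)]
    refine Finset.sum_congr rfl fun t _ => ?_
    have : (t : V) ∈ sphere G o n ↔ G.dist o t = n := mem_sphere hG
    rw [neighborFinset_sdiff_box hG t.2, glue_apply_coe]
    simp only [this]
    split_ifs
    · rw [successorCount, Finset.card_filter]
      push_cast
      exact Finset.sum_congr rfl fun s _ => by simp only [eq_comm]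
    · simp
  have hs : ∀ t ∈ sphere G o n, J * (successorCount G o ω t (glue (box G o n) ω ζ t) : ℝ) =
      J * b + hvec q m (J * (a - b)) (glue (box G o n) ω ζ t) := fun t ht => by
    rw [hω t (ne_of_mem_sphere hG hn ht), hvec]
    split_ifs
    · ring
    · ring
  rw [energy, hb, agreeingEdges_eq_agree _ ω, neg_mul]
  have hsum := Finset.sum_congr rfl hs
  rw [← Finset.mul_sum, Finset.sum_add_distrib, Finset.sum_const, nsmul_eq_mul] at hsum
  linarith

theorem real_gibbs (J : ℝ) (A : Finset V) (ω : V → Fin q) {S : Set (V → Fin q)}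
    (hS : MeasurableSet S) :
    (gibbs G J A ω : Measure (V → Fin q)).real S =
      (∑ ζ : A → Fin q, (if glue A ω ζ ∈ S then 1 else 0) * Real.exp (-energy G J A ω ζ)) /
        ∑ ζ : A → Fin q, Real.exp (-energy G J A ω ζ) := by
  change (gibbsMeasure G J A ω).real S = _ / partitionFn G J A ω
  have hZ := partitionFn_pos G J A ω
  unfold gibbsMeasure Measure.real
  simp only [Measure.coe_finsetSum, Finset.sum_apply, Measure.smul_apply, smul_eq_mul]
  rw [ENNReal.toReal_sum fun ζ _ => ENNReal.mul_ne_top ENNReal.ofReal_ne_top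
    (measure_ne_top _ _), Finset.sum_div]
  refine Finset.sum_congr rfl fun ζ _ => ?_
  rw [ENNReal.toReal_mul, ENNReal.toReal_ofReal (by positivity), Measure.dirac_apply' _ hS]
  by_cases h : glue A ω ζ ∈ S
  · simp only [Set.indicator_of_mem h, if_pos h, Pi.one_apply, ENNReal.toReal_one]; ring
  · simp [h]

variable (G o) in
/-- The configurations that agree with `η` on `V_n`. -/
def cylinderBox (n : ℕ) (η : box G o n → Fin q) : Set (V → Fin q) :=
  {σ | ∀ t : box G o n, σ t = η t}

theorem isClopen_cylinderBox (n : ℕ) (η : box G o n → Fin q) :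
    IsClopen (cylinderBox G o n η) := by
  have : cylinderBox G o n η = ⋂ t : box G o n, (fun σ : V → Fin q => σ t) ⁻¹' {η t} := by
    ext σ; simp [cylinderBox]
  rw [this]
  exact isClopen_iInter_of_finite fun t =>
    (isClopen_discrete {η t}).preimage (continuous_apply (t : V))

/-- The probability of `η` in the marginal on `V_n` prescribed by the vector `h`. -/
noncomputable def splittingProb (G : SimpleGraph V) (o : V) [G.LocallyFinite] (J : ℝ)
    (h : Fin q → ℝ) (n : ℕ) (η : box G o n → Fin q) : ℝ :=
  splittingWeight G o J h n η / ∑ ξ : box G o n → Fin q, splittingWeight G o J h n ξ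

/-- Numerator and denominator acquire the same constants from the energy and from the summation over
the outer spheres, so these cancel in the quotient. -/
theorem real_gibbs_cylinderBox [Countable V] (hG : G.IsTree) (hdeg : G.IsRegularOfDegree 3)
    {J : ℝ} (hJ : 0 < J) {m a b : ℕ} {ω : V → Fin q} (hω : InB G o m a b ω) {r : ℕ} (hr : 1 ≤ r)
    (d : ℕ) (η : box G o r → Fin q) :
    (gibbs G J (box G o (r + d)) ω : Measure (V → Fin q)).real (cylinderBox G o r η) =
      splittingProb G o J ((lawMap (Real.exp J))^[d] (hvec q m (J * (a - b)))) r η := by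
  set h := hvec q m (J * (a - b))
  set K := Real.exp (J * b * (sphere G o (r + d)).card)
  have hK : K ≠ 0 := (Real.exp_pos _).ne'
  have hE : ∀ ζ : box G o (r + d) → Fin q, Real.exp (-energy G J (box G o (r + d)) ω ζ) =
      K * weight G o J h (r + d) (glue (box G o (r + d)) ω ζ) := fun ζ => by
    rw [neg_energy_box hG J (by omega) hω, Real.exp_add, weight]
  obtain ⟨C, hC, hCw⟩ := sumOver_weight_sdiff (q := q) (o := o) hG hdeg hJ hr d h
  have hbox : box G o (r + d) = box G o r ∪ (box G o (r + d) \ box G o r) :=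
    (Finset.union_sdiff_of_subset (box_mono hG (by omega))).symm
  have hsplit : ∀ f : (V → Fin q) → ℝ, ∑ ζ, f (glue (box G o (r + d)) ω ζ) =
      ∑ ξ, sumOver (box G o (r + d) \ box G o r) f (glue (box G o r) ω ξ) := fun f => by
    have := sumOver_union (Finset.disjoint_sdiff (s := box G o r) (t := box G o (r + d))) f ω
    rwa [← hbox] at this
  have hden : ∑ ζ, Real.exp (-energy G J (box G o (r + d)) ω ζ) =
      K * C * ∑ ξ, splittingWeight G o J ((lawMap (Real.exp J))^[d] h) r ξ := by
    simp only [hE]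
    rw [← Finset.mul_sum, hsplit]
    simp only [hCw, ← splittingWeight_eq_weight]
    rw [← Finset.mul_sum, mul_assoc]
  have hnum : ∑ ζ, (if glue (box G o (r + d)) ω ζ ∈ cylinderBox G o r η then 1 else 0) *
      Real.exp (-energy G J (box G o (r + d)) ω ζ) =
      K * C * splittingWeight G o J ((lawMap (Real.exp J))^[d] h) r η := by
    simp only [hE, mul_left_comm _ K]
    rw [← Finset.mul_sum, hsplit (fun τ => (if τ ∈ cylinderBox G o r η then 1 else 0) *
      weight G o J h (r + d) τ), Finset.sum_eq_single η]
    · have hmem : ∀ ζ, glue (box G o (r + d) \ box G o r) (glue (box G o r) ω η) ζ ∈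
          cylinderBox G o r η := fun ζ t => by
        rw [glue_apply_of_notMem _ _ (by simp), glue_apply_coe]
      have : sumOver (box G o (r + d) \ box G o r) (fun τ => (if τ ∈ cylinderBox G o r η then 1
          else 0) * weight G o J h (r + d) τ) (glue (box G o r) ω η) =
          sumOver (box G o (r + d) \ box G o r) (weight G o J h (r + d))
            (glue (box G o r) ω η) := by
        unfold sumOver
        simp only [hmem, if_true, one_mul]
      rw [this, hCw, ← splittingWeight_eq_weight, mul_assoc]
    · intro ξ _ hne
      refine Finset.sum_eq_zero fun ζ _ => ?_
      refine mul_eq_zero_of_left (if_neg fun hmem => ?_) _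
      refine hne (funext fun t => ?_)
      have := hmem t
      rwa [glue_apply_of_notMem _ _ (by simp), glue_apply_coe] at this
    · simp
  rw [real_gibbs J _ ω (isClopen_cylinderBox r η).isOpen.measurableSet, hden, hnum, splittingProb,
    mul_div_mul_left _ _ (mul_ne_zero hK hC.ne')]

theorem continuous_splittingProb (J : ℝ) (n : ℕ) (η : box G o n → Fin q) :
    Continuous fun h : Fin q → ℝ => splittingProb G o J h n η := by
  have hc : ∀ ξ : box G o n → Fin q, Continuous fun h : Fin q → ℝ =>
      splittingWeight G o J h n ξ := fun ξ => by
    unfold splittingWeight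
    refine Real.continuous_exp.comp (continuous_const.add (continuous_finsetSum _ fun t _ => ?_))
    split_ifs
    · exact continuous_apply _
    · exact continuous_const
  refine (hc η).div (continuous_finsetSum _ fun ξ _ => hc ξ) fun h => ?_
  exact (Finset.sum_pos (fun ξ _ => Real.exp_pos _) ⟨η, Finset.mem_univ _⟩).ne'

/-- A probability measure is determined by the cylinders over the boxes `V_n`, `n ≥ 1`. -/
theorem eq_of_cylinderBox_eq (hG : G.IsTree) {μ ν : ProbabilityMeasure (V → Fin q)}
    (h : ∀ n, 1 ≤ n → ∀ η : box G o n → Fin q,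
      (μ : Measure (V → Fin q)).real (cylinderBox G o n η) =
        (ν : Measure (V → Fin q)).real (cylinderBox G o n η)) : μ = ν := by
  have hbox : ∀ n, 1 ≤ n →
      (μ : Measure (V → Fin q)).map ((box G o n).restrict (π := fun _ => Fin q)) =
      (ν : Measure (V → Fin q)).map ((box G o n).restrict (π := fun _ => Fin q)) := fun n hn => by
    refine Measure.ext_of_singleton fun η => ?_
    have hpre : (box G o n).restrict (π := fun _ => Fin q) ⁻¹' {η} = cylinderBox G o n η := by
      ext σ
      simp [cylinderBox, funext_iff]
    rw [Measure.map_apply (Finset.measurable_restrict _) (measurableSet_singleton _),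
      Measure.map_apply (Finset.measurable_restrict _) (measurableSet_singleton _), hpre]
    exact (measureReal_eq_measureReal_iff).1 (h n hn η)
  refine Subtype.ext (IsProjectiveLimit.unique
    (P := fun I : Finset V => (ν : Measure (V → Fin q)).map I.restrict) (fun I => ?_)
    (fun I => rfl))
  -- The added 1 guarantees `1 ≤ n`, even for empty `I`.
  set n := I.sup (fun t => G.dist o t) + 1
  have hI : I ⊆ box G o n := fun t ht => by
    rw [mem_box G o hG.connected]
    exact (Finset.le_sup (f := fun t => G.dist o t) ht).trans (Nat.le_succ _)
  have hmap : ∀ ρ : Measure (V → Fin q), ρ.map (I.restrict (π := fun _ => Fin q)) =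
      (ρ.map ((box G o n).restrict (π := fun _ => Fin q))).map
        (Finset.restrict₂ (π := fun _ => Fin q) hI) := fun ρ => by
    rw [Measure.map_map (Finset.measurable_restrict₂ hI) (Finset.measurable_restrict _)]
    rfl
  change (μ : Measure (V → Fin q)).map I.restrict = (ν : Measure (V → Fin q)).map I.restrict
  rw [hmap, hmap, hbox n (by omega)]

/-- Convergence of the probabilities of the cylinders over boxes implies weak convergence, to a
measure with the limiting cylinder probabilities. -/
theorem exists_tendsto_of_tendsto_cylinderBox [Countable V] (hG : G.IsTree)
    {μ : ℕ → ProbabilityMeasure (V → Fin q)} {π : ∀ n, (box G o n → Fin q) → ℝ}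
    (h : ∀ n, 1 ≤ n → ∀ η : box G o n → Fin q, Tendsto
      (fun k => (μ k : Measure (V → Fin q)).real (cylinderBox G o n η)) atTop (𝓝 (π n η))) :
    ∃ ν : ProbabilityMeasure (V → Fin q), (∀ n, 1 ≤ n → ∀ η : box G o n → Fin q,
      (ν : Measure (V → Fin q)).real (cylinderBox G o n η) = π n η) ∧
      Tendsto μ atTop (𝓝 ν) := by
  -- Cylinders are clopen, so their probabilities are continuous in the measure and every cluster
  -- point has the values `π`. By compactness a cluster point exists; it is unique, so the sequence
  -- converges to it.
  have hcl : ∀ ν : ProbabilityMeasure (V → Fin q), MapClusterPt ν atTop μ →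
      ∀ n, 1 ≤ n → ∀ η : box G o n → Fin q,
        (ν : Measure (V → Fin q)).real (cylinderBox G o n η) = π n η := fun ν hν n hn η => by
    have hcont : Tendsto (fun ρ : ProbabilityMeasure (V → Fin q) =>
        (ρ : Measure (V → Fin q)).real (cylinderBox G o n η)) (𝓝 ν)
        (𝓝 ((ν : Measure (V → Fin q)).real (cylinderBox G o n η))) :=
      (NNReal.continuous_coe.tendsto _).comp
        (ProbabilityMeasure.tendsto_measure_of_isClopen_of_tendsto tendsto_id
          (isClopen_cylinderBox n η))
    have h1 : ClusterPt _ (map _ atTop) := hν.tendsto_comp hcont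
    have h2 : (𝓝 _ ⊓ 𝓝 (π n η)).NeBot := h1.neBot.mono (inf_le_inf_left _ (h n hn η))
    exact eq_of_nhds_neBot h2
  obtain ⟨ν, hν⟩ := exists_clusterPt_of_compactSpace (map μ atTop)
  refine ⟨ν, hcl ν hν, tendsto_nhds_of_unique_mapClusterPt fun ρ hρ => ?_⟩
  exact eq_of_cylinderBox_eq (o := o) hG fun n hn η => by
    rw [hcl ρ hρ n hn η, hcl ν hν n hn η]

end Cylinders

/-! ### Reduction of the weak limit to the scalar recursion. -/

section Limit

variable {q m : ℕ} {θ : ℝ}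

theorem sum_exp_hvec (hmq : m ≤ q) (x : ℝ) :
    ∑ j, Real.exp (hvec q m x j) = m * Real.exp x + (q - m) := by
  have : ∀ j : Fin q, Real.exp (hvec q m x j) =
      if (j : ℕ) < m then Real.exp x else 1 := fun j => by
    unfold hvec; split_ifs <;> simp
  simp only [this]
  rw [Fin.sum_univ_eq_sum_range (fun j => if j < m then Real.exp x else 1) q,
    ← Finset.sum_range_add_sum_Ico _ hmq,
    Finset.sum_congr rfl fun j hj => if_pos (Finset.mem_range.1 hj),
    Finset.sum_congr (s₁ := Finset.Ico m q) rfl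
      fun j hj => if_neg (not_lt.2 (Finset.mem_Ico.1 hj).1)]
  simp [Nat.cast_sub hmq]

/-- At a zero entry the numerator of `lawMap` equals the denominator, so the entry stays zero. -/
theorem lawMap_hvec (hm : 0 < m) (hmq : m ≤ q) (hθ : 1 < θ) (x : ℝ) :
    lawMap θ (hvec q m x) = hvec q m (scalarMap q m θ x) := by
  have hm' : (0 : ℝ) < m := by exact_mod_cast hm
  have hq : (0 : ℝ) ≤ q - m := sub_nonneg.2 (by exact_mod_cast hmq)
  have := mul_pos hm' (Real.exp_pos x)
  funext i
  rw [lawMap, sum_exp_hvec hmq]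
  by_cases hi : (i : ℕ) < m
  · simp only [hvec, hi, if_true, scalarMap]
    congr 3 <;> ring
  · simp only [hvec, hi, if_false, Real.exp_zero, mul_one]
    rw [div_self (by linarith), Real.log_one, mul_zero]

theorem iterate_lawMap_hvec (hm : 0 < m) (hmq : m ≤ q) (hθ : 1 < θ) (d : ℕ) (x : ℝ) :
    (lawMap θ)^[d] (hvec q m x) = hvec q m ((scalarMap q m θ)^[d] x) :=
  (Function.Semiconj.iterate_right (fun x => (lawMap_hvec hm hmq hθ x).symm) d x).symm

theorem continuous_hvec : Continuous (hvec q m) :=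
  continuous_pi fun l => by
    unfold hvec
    split_ifs
    · exact continuous_id
    · exact continuous_const

theorem hvec_zero : hvec q m 0 = 0 := by
  funext l
  simp [hvec]

variable {V : Type*} [Countable V] {G : SimpleGraph V} [G.LocallyFinite] {o : V}

/-- If the scalar recursion started at `J (a - b)` converges to `x`, then the limiting Gibbs
measure is the TISGM corresponding to `hvec q m x`. -/
theorem limitIsTISGM_of_tendsto (hG : G.IsTree) (hdeg : G.IsRegularOfDegree 3) (hm : 0 < m)
    (hmq : m ≤ q) {J : ℝ} (hJ : 0 < J) {ω : V → Fin q} {a b : ℕ} (hω : InB G o m a b ω) {x : ℝ}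
    (hx : Tendsto (fun n => (scalarMap q m (Real.exp J))^[n] (J * (a - b))) atTop (𝓝 x)) :
    LimitIsTISGM G o 2 J ω (hvec q m x) := by
  have hθ : 1 < Real.exp J := Real.one_lt_exp_iff.2 hJ
  -- A limit of iterates is a fixed point; this is the boundary law equation for `hvec q m x`.
  have hfix : scalarMap q m (Real.exp J) x = x :=
    isFixedPt_of_tendsto_iterate hx (continuous_scalarMap hm hmq hθ).continuousAt
  have hlim : ∀ n, 1 ≤ n → ∀ η : box G o n → Fin q, Tendsto (fun k =>
      (gibbs G J (box G o k) ω : Measure (V → Fin q)).real (cylinderBox G o n η)) atTop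
      (𝓝 (splittingProb G o J (hvec q m x) n η)) := fun n hn η => by
    rw [← tendsto_add_atTop_iff_nat n]
    simp only [add_comm _ n]
    simp only [real_gibbs_cylinderBox hG hdeg hJ hω hn, iterate_lawMap_hvec hm hmq hθ]
    exact ((continuous_splittingProb J n η).tendsto _).comp
      ((continuous_hvec.tendsto x).comp hx)
  obtain ⟨μ, hμ, hμlim⟩ := exists_tendsto_of_tendsto_cylinderBox hG hlim
  refine ⟨μ, ⟨fun i => ?_, hμ⟩, fun ν hν => ?_, hμlim⟩
  · conv_lhs => rw [← hfix, ← lawMap_hvec hm hmq hθ]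
    rw [lawMap, Nat.cast_two]
  · exact eq_of_cylinderBox_eq (o := o) hG fun n hn η => (hν.marginal n hn η).trans
      (hμ n hn η).symm

end Limit

end Potts

namespace Potts

/-! ### Basins of attraction of h₂, 0 and h₁. -/

section Dynamics

variable {q m : ℕ} {θ x₀ : ℝ}

/-- The second alternative in `hx` admits a start at h₂ itself, needed when h₁ = h₂. -/
theorem tendsto_iterate_scalarMap_h2 (hm : 1 ≤ m) (hmq : m ≤ q / 2) (hθ1 : 1 < θ)
    (hθ : thetaM q m ≤ θ) (h0 : 0 ≤ h2 q m θ)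
    (hx : max 0 (h1 q m θ) < x₀ ∨ h2 q m θ ≤ x₀) :
    Tendsto (fun n => (scalarMap q m θ)^[n] x₀) atTop (𝓝 (h2 q m θ)) := by
  obtain ⟨ha, hp, -⟩ := exp_half_h1_h2 hm hmq hθ
  have hle := h1_le_h2 hm hmq hθ
  have hmq' : m ≤ q := by omega
  have hfix := scalarMap_eq hm hmq' hθ1 ha hp (x := h2 q m θ) (Or.inr (Or.inr rfl))
  have hmono := monotone_scalarMap hm hmq' hθ1
  have hcont := continuous_scalarMap hm hmq' hθ1
  rcases le_total (h2 q m θ) x₀ with h | h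
  · refine tendsto_iterate_of_lt hmono hcont hfix h fun x hx1 _ => ?_
    exact scalarMap_lt hm hmq' hθ1 ha hp (mul_pos (mul_pos (exp_half_sub_pos (by linarith))
      (exp_half_sub_pos (by linarith))) (exp_half_sub_pos hx1))
  · refine tendsto_iterate_of_gt hmono hcont hfix h fun x hx1 hx2 => ?_
    rcases hx with hx | hx
    · rw [max_lt_iff] at hx
      exact lt_scalarMap hm hmq' hθ1 ha hp (mul_neg_of_pos_of_neg (mul_pos
        (exp_half_sub_pos (by linarith)) (exp_half_sub_pos (by linarith))) (exp_half_sub_neg hx1))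
    · linarith

/-- The alternative `x₀ ≤ 0` admits x₀ = h₁ = 0, which occurs at θ = q + 1. -/
theorem tendsto_iterate_scalarMap_zero (hm : 1 ≤ m) (hmq : m ≤ q / 2) (hθ1 : 1 < θ)
    (hθ : thetaM q m ≤ θ) (h0 : 0 ≤ h1 q m θ) (hx : x₀ < h1 q m θ ∨ x₀ ≤ 0) :
    Tendsto (fun n => (scalarMap q m θ)^[n] x₀) atTop (𝓝 0) := by
  obtain ⟨ha, hp, -⟩ := exp_half_h1_h2 hm hmq hθ
  have hle := h1_le_h2 hm hmq hθ
  have hmq' : m ≤ q := by omega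
  have hfix := scalarMap_eq hm hmq' hθ1 ha hp (x := 0) (Or.inl rfl)
  have hmono := monotone_scalarMap hm hmq' hθ1
  have hcont := continuous_scalarMap hm hmq' hθ1
  rcases le_total 0 x₀ with h | h
  · refine tendsto_iterate_of_lt hmono hcont hfix h fun x hx1 hx2 => ?_
    rcases hx with hx | hx
    · exact scalarMap_lt hm hmq' hθ1 ha hp (mul_pos_of_neg_of_neg (mul_neg_of_pos_of_neg
        (exp_half_sub_pos hx1) (exp_half_sub_neg (by linarith))) (exp_half_sub_neg (by linarith)))
    · linarith
  · refine tendsto_iterate_of_gt hmono hcont hfix h fun x hx1 _ => ?_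
    exact lt_scalarMap hm hmq' hθ1 ha hp (mul_neg_of_pos_of_neg (mul_pos_of_neg_of_neg
      (exp_half_sub_neg hx1) (exp_half_sub_neg (by linarith))) (exp_half_sub_neg (by linarith)))

theorem tendsto_iterate_scalarMap_h1 (hm : 1 ≤ m) (hmq : m ≤ q / 2) (hθ1 : 1 < θ)
    (hθ : thetaM q m ≤ θ) (h0 : h1 q m θ ≤ 0) (h0' : 0 ≤ h2 q m θ) (hx : x₀ < 0) :
    Tendsto (fun n => (scalarMap q m θ)^[n] x₀) atTop (𝓝 (h1 q m θ)) := by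
  obtain ⟨ha, hp, -⟩ := exp_half_h1_h2 hm hmq hθ
  have hmq' : m ≤ q := by omega
  have hfix := scalarMap_eq hm hmq' hθ1 ha hp (x := h1 q m θ) (Or.inr (Or.inl rfl))
  have hmono := monotone_scalarMap hm hmq' hθ1
  have hcont := continuous_scalarMap hm hmq' hθ1
  rcases le_total (h1 q m θ) x₀ with h | h
  · refine tendsto_iterate_of_lt hmono hcont hfix h fun x hx1 hx2 => ?_
    exact scalarMap_lt hm hmq' hθ1 ha hp (mul_pos_of_neg_of_neg (mul_neg_of_neg_of_pos
      (exp_half_sub_neg (by linarith)) (exp_half_sub_pos hx1)) (exp_half_sub_neg (by linarith)))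
  · refine tendsto_iterate_of_gt hmono hcont hfix h fun x hx1 _ => ?_
    exact lt_scalarMap hm hmq' hθ1 ha hp (mul_neg_of_pos_of_neg (mul_pos_of_neg_of_neg
      (exp_half_sub_neg (by linarith)) (exp_half_sub_neg hx1)) (exp_half_sub_neg (by linarith)))

theorem tendsto_iterate_of_fixed {f : ℝ → ℝ} (h : f x₀ = x₀) :
    Tendsto (fun n => f^[n] x₀) atTop (𝓝 x₀) := by
  simp only [Function.iterate_fixed h]
  exact tendsto_const_nhds

end Dynamics

end Potts

/-! ### The four temperature regimes. -/

theorem mainTheorem1 {V : Type*} [Countable V] (G : SimpleGraph V) [G.LocallyFinite]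
    (hG : G.IsTree) (hdeg : G.IsRegularOfDegree 3) (o : V)
    (q m : ℕ) (hm : 1 ≤ m) (hmq : m ≤ q / 2)
    (J θ : ℝ) (hJ : 0 < J) (hθ : θ = Real.exp J)
    (ω : V → Fin q) (a b : ℕ) (hω : Potts.InB G o m a b ω) :
    (θ = Potts.thetaM q m →
      (Potts.h1 q m θ ≤ J * ((a : ℝ) - b) →
        Potts.LimitIsTISGM G o 2 J ω (Potts.hvec q m (Potts.h1 q m θ))) ∧
      (J * ((a : ℝ) - b) < Potts.h1 q m θ →
        Potts.LimitIsTISGM G o 2 J ω 0)) ∧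
    (Potts.thetaM q m < θ → θ < q + 1 →
      (Potts.h1 q m θ < J * ((a : ℝ) - b) →
        Potts.LimitIsTISGM G o 2 J ω (Potts.hvec q m (Potts.h2 q m θ))) ∧
      (J * ((a : ℝ) - b) = Potts.h1 q m θ →
        Potts.LimitIsTISGM G o 2 J ω (Potts.hvec q m (Potts.h1 q m θ))) ∧
      (J * ((a : ℝ) - b) < Potts.h1 q m θ →
        Potts.LimitIsTISGM G o 2 J ω 0)) ∧
    (θ = q + 1 →
      (b < a → Potts.LimitIsTISGM G o 2 J ω (Potts.hvec q m (Potts.h2 q m θ))) ∧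
      (a ≤ b → Potts.LimitIsTISGM G o 2 J ω 0)) ∧
    (q + 1 < θ →
      (b < a → Potts.LimitIsTISGM G o 2 J ω (Potts.hvec q m (Potts.h2 q m θ))) ∧
      (a < b → Potts.LimitIsTISGM G o 2 J ω (Potts.hvec q m (Potts.h1 q m θ))) ∧
      (a = b → Potts.LimitIsTISGM G o 2 J ω 0)) := by
  have hmq' : m ≤ q := by omega
  have hθ1 : 1 < θ := hθ ▸ Real.one_lt_exp_iff.2 hJ
  have key : ∀ x, Tendsto (fun n => (Potts.scalarMap q m θ)^[n] (J * ((a : ℝ) - b))) atTop (𝓝 x) →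
      Potts.LimitIsTISGM G o 2 J ω (Potts.hvec q m x) := fun x hx =>
    Potts.limitIsTISGM_of_tendsto hG hdeg hm hmq' hJ hω (hθ ▸ hx)
  have key0 : Tendsto (fun n => (Potts.scalarMap q m θ)^[n] (J * ((a : ℝ) - b))) atTop (𝓝 0) →
      Potts.LimitIsTISGM G o 2 J ω 0 := fun hx => Potts.hvec_zero (q := q) (m := m) ▸ key 0 hx
  have hpos : b < a → 0 < J * ((a : ℝ) - b) := fun h =>
    mul_pos hJ (sub_pos.2 (by exact_mod_cast h))
  have hneg : a < b → J * ((a : ℝ) - b) < 0 := fun h =>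
    mul_neg_of_pos_of_neg hJ (sub_neg.2 (by exact_mod_cast h))
  have hnonpos : a ≤ b → J * ((a : ℝ) - b) ≤ 0 := fun h =>
    mul_nonpos_of_nonneg_of_nonpos hJ.le (sub_nonpos.2 (by exact_mod_cast h))
  refine ⟨fun hc => ?_, fun hc hc' => ?_, fun hc => ?_, fun hc => ?_⟩
  · have h0 := Potts.h1_nonneg hm hmq hc.ge (hc.le.trans (Potts.thetaM_le hm hmq))
    have h12 := Potts.h1_eq_h2 hm hmq hc
    refine ⟨fun hD => key _ ?_, fun hD => key0 ?_⟩
    -- At θ_m the two nonzero fixed points merge into one that attracts from above.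
    · rw [h12] at hD h0 ⊢
      exact Potts.tendsto_iterate_scalarMap_h2 hm hmq hθ1 hc.ge h0 (Or.inr hD)
    · exact Potts.tendsto_iterate_scalarMap_zero hm hmq hθ1 hc.ge h0 (Or.inl hD)
  · have h0 := Potts.h1_pos hm hmq hc.le hc'
    have h12 := Potts.h1_le_h2 hm hmq hc.le
    refine ⟨fun hD => key _ ?_, fun hD => key _ ?_, fun hD => key0 ?_⟩
    · exact Potts.tendsto_iterate_scalarMap_h2 hm hmq hθ1 hc.le (h0.le.trans h12)
        (Or.inl (max_lt (h0.trans hD) hD))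
    -- Here h₁ repels on both sides, so it is reached only by starting on it.
    · obtain ⟨ha, hp, -⟩ := Potts.exp_half_h1_h2 hm hmq hc.le
      rw [hD]
      exact Potts.tendsto_iterate_of_fixed
        (Potts.scalarMap_eq hm hmq' hθ1 ha hp (Or.inr (Or.inl rfl)))
    · exact Potts.tendsto_iterate_scalarMap_zero hm hmq hθ1 hc.le h0.le (Or.inl hD)
  · have hM : Potts.thetaM q m ≤ θ := (Potts.thetaM_le hm hmq).trans hc.ge
    have h0 := Potts.h1_eq_zero hm hmq hc
    have h12 := Potts.h1_le_h2 hm hmq hM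
    refine ⟨fun hD => key _ ?_, fun hD => key0 ?_⟩
    · exact Potts.tendsto_iterate_scalarMap_h2 hm hmq hθ1 hM (h0.ge.trans h12)
        (Or.inl (max_lt (hpos hD) (h0.symm ▸ hpos hD)))
    · exact Potts.tendsto_iterate_scalarMap_zero hm hmq hθ1 hM h0.ge (Or.inr (hnonpos hD))
  · have hM : Potts.thetaM q m ≤ θ := (Potts.thetaM_le hm hmq).trans hc.le
    obtain ⟨h1neg, h2pos⟩ := Potts.h1_neg_h2_pos hm hmq hc
    refine ⟨fun hD => key _ ?_, fun hD => key _ ?_, fun hD => key0 ?_⟩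
    · exact Potts.tendsto_iterate_scalarMap_h2 hm hmq hθ1 hM h2pos.le
        (Or.inl (max_lt (hpos hD) (h1neg.trans (hpos hD))))
    · exact Potts.tendsto_iterate_scalarMap_h1 hm hmq hθ1 hM h1neg.le h2pos.le (hneg hD)
    · obtain ⟨ha, hp, -⟩ := Potts.exp_half_h1_h2 hm hmq hM
      rw [hD, sub_self, mul_zero]
      exact Potts.tendsto_iterate_of_fixed (Potts.scalarMap_eq hm hmq' hθ1 ha hp (Or.inl rfl))
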